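/- All rings are commutative with one. A ring homomorphism $A\to B$ is called crisp (pure) if $P\to B\otimes_A P$ is injective for every $A$-module $P$. A surjective morphism $f\colon X\to Y$ of quasi-separated schemes is called crisp if every quasi-compact open subset of $Y$ is the image of a quasi-compact open subset of $X$, and there is an affine open covering $(V_j)_{j\in J}$ of $Y$ such that for every $j$ there are a quasi-compact open $U_j\subseteq f^{-1}(V_j)$ with $f(U_j)=V_j$ and a finite affine open covering $U_{j,1},\dots,U_{j,r_j}$ of $U_j$ for which the ring homomorphism $\mathcal{O}_Y(V_j)\to\prod_{i=1}^{r_j}\mathcal{O}_X(U_{j,i})$ corresponding to $\bigsqcup_{i=1}^{r_j}U_{j,i}\to V_j$ is crisp. A morphism of schemes is called submersive if it is surjective and its target carries the quotient topology. The constructible topology on a scheme is the topology whose open sets are the ind-constructible subsets, i.e. the subsets that are locally (on every affine open subscheme) unions of constructible subsets. A morphism of schemes $f\colon X\to Y$ is called subtrusive if (a) for all points $y,y'\in Y$ such that $y'$ is a specialisation of $y$ there are points $x,x'\in X$ such that $x'$ is a specialisation of $x$, $f(x)=y$ and $f(x')=y'$, and (b) $f$ is surjective and $Y$ carries the quotient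 topology with respect to $f$ when $X$ and $Y$ are given their constructible topologies. A morphism has one of these properties universally if for every morphism of schemes $Y'\to Y$ the base change $X\times_Y Y'\to Y'$ has it. Proposition. Let $f\colon X\to Y$ be a quasi-compact crisp morphism of (quasi-separated) schemes. Then $f$ is universally subtrusive; in particular, $f$ is universally submersive. -/

import Mathlib

open CategoryTheory AlgebraicGeometry Topology
open scoped TensorProduct Set.Notation

universe u

namespace Crisp

/-- A linear map `φ : M → N` of `A`-modules is crisp (pure, universally injective) if
`φ ⊗ id_P : M ⊗ P → N ⊗ P` is injective for all `A`-modules `P`. -/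
def LinearMapIsCrisp {A M N : Type u} [CommRing A] [AddCommGroup M] [AddCommGroup N]
    [Module A M] [Module A N] (φ : M →ₗ[A] N) : Prop :=
  ∀ (P : Type u) [AddCommGroup P] [Module A P], Function.Injective (φ.rTensor P)

/-- A ring homomorphism `A → B` is crisp if it is crisp as a map of `A`-modules. -/
def RingHomIsCrisp {A B : Type u} [CommRing A] [CommRing B] (φ : A →+* B) : Prop :=
  letI := φ.toAlgebra
  LinearMapIsCrisp (Algebra.linearMap A B)

variable {X Y : Scheme.{u}}

/-- A surjective morphism `f : X ⟶ Y` is locally quasi-compact surjective if every quasi-compact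
open of `Y` is the image of a quasi-compact open of `X`. -/
structure IsLocallyQuasiCompactSurjective (f : X ⟶ Y) : Prop where
  surjective : Function.Surjective f
  exists_image_eq : ∀ V : Y.Opens, IsCompact (V : Set Y) →
    ∃ U : X.Opens, IsCompact (U : Set X) ∧ f '' (U : Set X) = (V : Set Y)

/-- For opens `U₁, …, U_r ⊆ f⁻¹(V)`, the ring homomorphism `Γ(V) → ∏ i, Γ(U_i) = Γ(∐ i, U_i)`
corresponding to the morphism `∐ i, U_i ⟶ V` from the disjoint union of the `U_i`. -/
noncomputable def sectionsMap (f : X ⟶ Y) (V : Y.Opens) {r : ℕ} (U : Fin r → X.Opens)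
    (h : ∀ i, U i ≤ f ⁻¹ᵁ V) : Γ(Y, V) →+* (∀ i, Γ(X, U i)) :=
  RingHom.pi fun i ↦ (f.appLE V (U i) (h i)).hom

/-- Crispness of `f` over an affine open `V ⊆ Y`: there is a quasi-compact open `U ⊆ f⁻¹(V)` with
`f(U) = V` and a finite affine open covering `U₁, …, U_r` of `U` such that the ring homomorphism
corresponding to `∐ i, U_i ⟶ V` is crisp. -/
def IsCrispOver (f : X ⟶ Y) (V : Y.Opens) : Prop :=
  ∃ U : X.Opens, IsCompact (U : Set X) ∧ U ≤ f ⁻¹ᵁ V ∧ f '' (U : Set X) = (V : Set Y) ∧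
    ∃ (r : ℕ) (W : Fin r → X.Opens) (hW : ∀ i, W i ≤ f ⁻¹ᵁ V),
      (∀ i, IsAffineOpen (W i)) ∧ ⨆ i, W i = U ∧ RingHomIsCrisp (sectionsMap f V W hW)

/-- A surjective morphism of quasi-separated schemes is crisp if it is locally quasi-compact
surjective and the target has an affine open covering over each member of which it is crisp. -/
structure IsCrisp (f : X ⟶ Y) : Prop where
  quasiSeparated_source : QuasiSeparatedSpace X
  quasiSeparated_target : QuasiSeparatedSpace Y
  isLocallyQuasiCompactSurjective : IsLocallyQuasiCompactSurjective f
  exists_cover : ∃ (J : Type u) (V : J → Y.Opens),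
    (∀ j, IsAffineOpen (V j)) ∧ ⨆ j, V j = ⊤ ∧ ∀ j, IsCrispOver f (V j)

/-- A subset of a scheme is ind-constructible if it is locally, that is on every affine open `U`,
a union of constructible subsets of `U`. -/
def IsIndConstructible (S : Set X) : Prop :=
  ∀ U : X.Opens, IsAffineOpen U →
    ∃ 𝒯 : Set (Set (U : Set X)), (∀ T ∈ 𝒯, IsConstructible T) ∧ ⋃₀ 𝒯 = (U : Set X) ↓∩ S

/-- The constructible topology on a scheme: the open sets are the ind-constructible sets. (On
schemes that are not quasi-separated it can differ from the topology generated by all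
quasi-compact opens and their complements.) -/
@[reducible]
def constructibleTopology (X : Scheme.{u}) : TopologicalSpace X where
  IsOpen S := IsIndConstructible S
  isOpen_univ := fun U _ ↦ ⟨{Set.univ}, by simp, by simp⟩
  isOpen_inter := by
    intro S S' hS hS' U hU
    obtain ⟨𝒯, h, e⟩ := hS U hU
    obtain ⟨𝒯', h', e'⟩ := hS' U hU
    refine ⟨Set.image2 (· ∩ ·) 𝒯 𝒯', ?_, ?_⟩
    · rintro _ ⟨T, hT, T', hT', rfl⟩
      exact (h T hT).inter (h' T' hT')
    · rw [Set.preimage_inter, ← e, ← e']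
      ext x
      simp only [Set.mem_sUnion, Set.mem_image2]
      constructor
      · rintro ⟨_, ⟨T, hT, T', hT', rfl⟩, hx, hx'⟩
        exact ⟨⟨T, hT, hx⟩, ⟨T', hT', hx'⟩⟩
      · rintro ⟨⟨T, hT, hx⟩, ⟨T', hT', hx'⟩⟩
        exact ⟨_, ⟨T, hT, T', hT', rfl⟩, hx, hx'⟩
  isOpen_sUnion := by
    intro 𝒮 h𝒮 U hU
    choose! 𝒯 h e using fun S hS ↦ h𝒮 S hS U hU
    refine ⟨⋃ S ∈ 𝒮, 𝒯 S, ?_, ?_⟩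
    · intro T hT
      obtain ⟨S, hS, hT⟩ := Set.mem_iUnion₂.mp hT
      exact h S hS T hT
    · rw [Set.preimage_sUnion]
      simp only [Set.sUnion_iUnion]
      exact Set.iUnion₂_congr e

/-- A morphism of schemes is submersive if it is surjective and the target carries the quotient
topology. -/
def IsSubmersive : MorphismProperty Scheme.{u} :=
  fun _ _ f ↦ IsQuotientMap f

/-- A morphism of schemes is subtrusive if every ordered pair of points (for the specialisation
order of the Zariski topology) of the target lifts to an ordered pair of points of the source, and
it is submersive for the constructible topologies. -/
def IsSubtrusive : MorphismProperty Scheme.{u} :=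
  fun X Y f ↦
    (∀ y y' : Y, y ⤳ y' → ∃ x x' : X, x ⤳ x' ∧ f x = y ∧ f x' = y') ∧
    @IsQuotientMap X Y (constructibleTopology X) (constructibleTopology Y) f

end Crisp

/-! Everything rests on lifting specialisations along an arbitrary base change. A specialisation is
the image of generic ⤳ closed in some `Spec R`, with `R` a valuation ring. The closed point lands in
some `V j` of the crisp covering, hence so does all of `Spec R`. With `A = Γ(Y, V j)`, `B = ∏ i,
Γ(X, W i)` and `C = B ⊗[A] R`, purity of `A → B` gives injectivity of `R/a → C/aC` for all `a`. This
forces generic ⤳ closed to lift to `Spec C` (`exists_le_comap_of_valuationRing`), which maps to the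
base change of `X`. The two topological claims then use quasi-compactness, which covers the preimage
of an affine open by one affine scheme. For constructible topologies, a surjective spectral map is a
continuous map from a compact to a Hausdorff space, hence closed. For Zariski topologies, a set with
closed preimage is stable under specialisation, and locally it is the image of a closed set of an
affine scheme, so it is closed. -/

namespace Crisp

/-! ### Purity and valuation rings -/

section Algebra

variable {A B R : Type u} [CommRing A] [CommRing B] [CommRing R] [Algebra A B] [Algebra A R]

/-- If `A → B` is crisp, every principal ideal of an `A`-algebra `R` is contracted from
`B ⊗[A] R`. -/
lemma LinearMapIsCrisp.dvd_of_includeRight_dvd (h : LinearMapIsCrisp (Algebra.linearMap A B))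
    {a r : R} (hd : (1 : B) ⊗ₜ[A] a ∣ (1 : B) ⊗ₜ[A] r) : a ∣ r := by
  obtain ⟨c, hc⟩ := hd
  -- Purity is applied with `P = R ⧸ I`: the relation kills `1 ⊗ r` in `B ⊗[A] (R ⧸ I)`, so `r`
  -- vanishes in `R ⧸ I`.
  let I : Ideal R := Ideal.span {a}
  have h0 := congrArg (Algebra.TensorProduct.map (AlgHom.id A B) (Ideal.Quotient.mkₐ A I)) hc
  have ha : Ideal.Quotient.mkₐ A I a = 0 :=
    Ideal.Quotient.eq_zero_iff_mem.mpr (Ideal.mem_span_singleton_self a)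
  rw [map_mul, Algebra.TensorProduct.map_tmul, Algebra.TensorProduct.map_tmul, ha,
    TensorProduct.tmul_zero, zero_mul] at h0
  have h1 : (1 : A) ⊗ₜ[A] (Ideal.Quotient.mkₐ A I r) = 0 := by
    apply h (R ⧸ I)
    rw [LinearMap.rTensor_tmul, map_zero, Algebra.linearMap_apply, map_one]
    exact h0
  have h2 := congrArg (TensorProduct.lid A (R ⧸ I)) h1
  rw [TensorProduct.lid_tmul, one_smul, map_zero] at h2
  exact Ideal.mem_span_singleton.mp (Ideal.Quotient.eq_zero_iff_mem.mp h2)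

/-- The specialisation from the generic to the closed point of a valuation ring lifts along a
ring homomorphism that reflects divisibility. -/
lemma exists_le_comap_of_valuationRing {R C : Type*} [CommRing R] [IsDomain R] [ValuationRing R]
    [CommRing C] (ι : R →+* C) (hι : ∀ a r, ι a ∣ ι r → a ∣ r) :
    ∃ q q' : PrimeSpectrum C, q ≤ q' ∧ PrimeSpectrum.comap ι q = ⊥ ∧
      PrimeSpectrum.comap ι q' = IsLocalRing.closedPoint R := by
  let 𝔪 := IsLocalRing.maximalIdeal R
  -- `J` is `𝔪C` plus the `R`-torsion of `C`. One `m` suffices for each element because finitely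
  -- generated ideals of `R` are principal.
  let J : Ideal C :=
    { carrier := {c | ∃ s : R, s ≠ 0 ∧ ∃ m ∈ 𝔪, ∃ d, ι s * c = ι s * (ι m * d)}
      zero_mem' := ⟨1, one_ne_zero, 0, zero_mem _, 0, by simp⟩
      add_mem' := by
        rintro c c' ⟨s, hs, m, hm, d, h⟩ ⟨s', hs', m', hm', d', h'⟩
        obtain ⟨t, rfl⟩ | ⟨t, rfl⟩ := ValuationRing.dvd_total m m'
        · refine ⟨s * s', mul_ne_zero hs hs', m, hm, d + ι t * d', ?_⟩
          simp only [map_mul] at h' ⊢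
          linear_combination ι s' * h + ι s * h'
        · refine ⟨s * s', mul_ne_zero hs hs', m', hm', d' + ι t * d, ?_⟩
          simp only [map_mul] at h ⊢
          linear_combination ι s' * h + ι s * h'
      smul_mem' := by
        rintro x c ⟨s, hs, m, hm, d, h⟩
        refine ⟨s, hs, m, hm, x * d, ?_⟩
        rw [smul_eq_mul]
        linear_combination x * h }
  have hJ : J ≠ ⊤ := by
    rw [Ideal.ne_top_iff_one]
    rintro ⟨s, hs, m, hm, d, h⟩
    -- If `1 ∈ J`, then `s * m` divides `s` in `C`, hence in `R`, and `m` would be a unit.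
    obtain ⟨t, ht⟩ := hι (s * m) s ⟨d, by rw [map_mul]; linear_combination h⟩
    refine hm (IsUnit.of_mul_eq_one t (mul_left_cancel₀ hs ?_))
    linear_combination -ht
  obtain ⟨q', hq', hJq'⟩ := Ideal.exists_le_maximal J hJ
  have hprime := hq'.isPrime
  -- A prime avoiding `N` lies below `q'` and over the generic point. It exists because `ι s * c =
  -- 0` with `s ≠ 0` makes `c` torsion, so `c ∈ J ≤ q'`.
  let N : Submonoid C := ((nonZeroDivisors R).map ι) ⊔ q'.primeCompl
  have hN : Disjoint ((⊥ : Ideal C) : Set C) (N : Set C) := by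
    rw [Set.disjoint_left]
    rintro x rfl hx
    obtain ⟨_, ⟨s, hs, rfl⟩, c, hc, h⟩ := Submonoid.mem_sup.mp hx
    exact hc (hJq' ⟨s, nonZeroDivisors.ne_zero hs, 0, zero_mem _, 0, by simpa using h⟩)
  obtain ⟨q, hq, -, hqN⟩ := Ideal.exists_le_prime_disjoint _ _ hN
  rw [Set.disjoint_left] at hqN
  refine ⟨⟨q, hq⟩, ⟨q', hprime⟩, ?_, ?_, ?_⟩
  · intro x hx
    by_contra hx'
    exact hqN hx (Submonoid.mem_sup_right hx')
  · refine PrimeSpectrum.ext (eq_bot_iff.mpr fun s hs ↦ ?_)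
    by_contra h0
    exact hqN hs (Submonoid.mem_sup_left ⟨s, mem_nonZeroDivisors_of_ne_zero h0, rfl⟩)
  · refine PrimeSpectrum.ext (((IsLocalRing.maximalIdeal.isMaximal R).eq_of_le
      (Ideal.IsPrime.ne_top inferInstance) fun m hm ↦ ?_).symm)
    exact hJq' ⟨1, one_ne_zero, m, hm, 1, by simp⟩

end Algebra

/-! ### Lifting specialisations along base changes -/

section Specialization

/-- Every specialisation in a scheme is the image of the one from the generic to the closed point
of a valuation ring. -/
lemma exists_valuationRing_of_specializes {Y : Scheme.{u}} {y y' : Y} (h : y ⤳ y') :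
    ∃ (R : Type u) (_ : CommRing R) (_ : IsDomain R) (_ : ValuationRing R)
      (g : Spec (.of R) ⟶ Y), g (⊥ : PrimeSpectrum R) = y ∧ g (IsLocalRing.closedPoint R) = y' := by
  let φ : Y.presheaf.stalk y' ⟶ Y.residueField y :=
    Y.presheaf.stalkSpecializes h ≫ Y.residue y
  -- `R` is a valuation subring of the residue field at `y`; locality of the map from the stalk at
  -- `y'` sends the closed point to `y'`.
  obtain ⟨R, hR, hloc⟩ := IsLocalRing.exists_factor_valuationRing φ.hom
  let ψ : Y.presheaf.stalk y' ⟶ .of R := CommRingCat.ofHom (φ.hom.codRestrict _ hR)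
  have w : Y.fromSpecResidueField y =
      Spec.map (CommRingCat.ofHom (algebraMap R (Y.residueField y))) ≫
        Spec.map ψ ≫ Y.fromSpecStalk y' := by
    rw [Scheme.fromSpecResidueField, ← Scheme.SpecMap_stalkSpecializes_fromSpecStalk h]
    simp_rw [← Spec.map_comp_assoc]
    rfl
  let η : Spec (Y.residueField y) := IsLocalRing.closedPoint (Y.residueField y)
  have hη : Spec.map (CommRingCat.ofHom (algebraMap R (Y.residueField y))) η =
      (⊥ : PrimeSpectrum R) := by
    refine PrimeSpectrum.ext (eq_bot_iff.mpr fun s hs ↦ ?_)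
    replace hs : algebraMap R (Y.residueField y) s ∈
        IsLocalRing.maximalIdeal (Y.residueField y) := hs
    rw [IsLocalRing.maximalIdeal_eq_bot, Ideal.mem_bot] at hs
    exact (FaithfulSMul.algebraMap_eq_zero_iff R (Y.residueField y)).mp hs
  have hc : Spec.map ψ (IsLocalRing.closedPoint R) =
      IsLocalRing.closedPoint (Y.presheaf.stalk y') :=
    IsLocalRing.comap_closedPoint (S := R) (φ.hom.codRestrict R.toSubring hR)
  refine ⟨R, inferInstance, inferInstance, inferInstance, Spec.map ψ ≫ Y.fromSpecStalk y',
    (congrArg (Spec.map ψ ≫ Y.fromSpecStalk y') hη).symm.trans ?_,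
    (congrArg (Y.fromSpecStalk y') hc).trans Y.fromSpecStalk_closedPoint⟩
  rw [← Scheme.Hom.comp_apply, ← w]
  exact Scheme.fromSpecResidueField_apply y η

/-- For affine opens `W i ≤ f ⁻¹ᵁ V` the morphism `∐ i, W i ⟶ X` as a morphism from
`Spec (∏ i, Γ(X, W i))`. -/
lemma exists_hom_of_sectionsMap {X Y : Scheme.{u}} (f : X ⟶ Y) {V : Y.Opens} (hV : IsAffineOpen V)
    {r : ℕ} (W : Fin r → X.Opens) (h : ∀ i, W i ≤ f ⁻¹ᵁ V) (hW : ∀ i, IsAffineOpen (W i)) :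
    ∃ g : Spec (.of (∀ i, Γ(X, W i))) ⟶ X,
      g ≫ f = Spec.map (CommRingCat.ofHom (sectionsMap f V W h)) ≫ hV.fromSpec := by
  let p := sigmaSpec fun i : ULift.{u} (Fin r) ↦ Γ(X, W i.down)
  let σ : Γ(Y, V) →+* (∀ i : ULift.{u} (Fin r), Γ(X, W i.down)) :=
    RingHom.pi fun i ↦ (f.appLE V (W i.down) (h i.down)).hom
  let ρ : (∀ i : ULift.{u} (Fin r), Γ(X, W i.down)) →+* (∀ i, Γ(X, W i)) :=
    RingHom.pi fun i ↦ Pi.evalRingHom (fun i : ULift.{u} (Fin r) ↦ Γ(X, W i.down)) ⟨i⟩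
  have hσ : (inv p ≫ Limits.Sigma.desc fun i ↦ (hW i.down).fromSpec) ≫ f =
      Spec.map (CommRingCat.ofHom σ) ≫ hV.fromSpec := by
    rw [← cancel_epi p, Category.assoc, IsIso.hom_inv_id_assoc]
    refine Limits.Sigma.hom_ext _ _ fun i ↦ ?_
    rw [Limits.Sigma.ι_desc_assoc, ι_sigmaSpec_assoc, ← Spec.map_comp_assoc,
      ← IsAffineOpen.SpecMap_appLE_fromSpec f hV (hW i.down) (h i.down)]
    rfl
  refine ⟨Spec.map (CommRingCat.ofHom ρ) ≫ inv p ≫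
    Limits.Sigma.desc fun i ↦ (hW i.down).fromSpec, ?_⟩
  rw [Category.assoc, hσ, ← Spec.map_comp_assoc]
  rfl

/-- Specialisations lift along every base change of a crisp morphism. -/
lemma IsCrisp.exists_specializes {X Y X' Y' : Scheme.{u}} {f : X ⟶ Y} (hf : IsCrisp f)
    {i₁ : X' ⟶ X} {i₂ : Y' ⟶ Y} {f' : X' ⟶ Y'} (hp : IsPullback f' i₁ i₂ f) {y y' : Y'}
    (h : y ⤳ y') : ∃ x x' : X', x ⤳ x' ∧ f' x = y ∧ f' x' = y' := by
  obtain ⟨R, _, _, _, g, rfl, rfl⟩ := exists_valuationRing_of_specializes h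
  obtain ⟨J, V, hV, htop, hcr⟩ := hf.exists_cover
  obtain ⟨j, hj⟩ : ∃ j, (g ≫ i₂) (IsLocalRing.closedPoint R) ∈ V j := by
    rw [← TopologicalSpace.Opens.mem_iSup, htop]
    trivial
  obtain ⟨-, -, -, -, r, W, hW, hWa, -, hB⟩ := hcr j
  obtain ⟨k, hk⟩ := exists_hom_of_sectionsMap f (hV j) W hW hWa
  -- An open set containing the image of the closed point contains the image of each of its
  -- generisations.
  have hrange : Set.range (g ≫ i₂) ⊆ Set.range (hV j).fromSpec := by
    rw [(hV j).range_fromSpec]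
    rintro _ ⟨x, rfl⟩
    exact ((IsLocalRing.specializes_closedPoint x).map (g ≫ i₂).continuous).mem_open (V j).2 hj
  obtain ⟨φ, hφ⟩ := Spec.map_surjective (IsOpenImmersion.lift (hV j).fromSpec (g ≫ i₂) hrange)
  have hg : Spec.map φ ≫ (hV j).fromSpec = g ≫ i₂ := by
    rw [hφ, IsOpenImmersion.lift_fac]
  let _ : Algebra Γ(Y, V j) R := φ.hom.toAlgebra
  let _ : Algebra Γ(Y, V j) (∀ i, Γ(X, W i)) := (sectionsMap f (V j) W hW).toAlgebra
  let C := (∀ i, Γ(X, W i)) ⊗[Γ(Y, V j)] R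
  let ι : R →+* C := Algebra.TensorProduct.includeRight.toRingHom
  let κ : (∀ i, Γ(X, W i)) →+* C := Algebra.TensorProduct.includeLeftRingHom
  obtain ⟨q, q', hle, hq, hq'⟩ := exists_le_comap_of_valuationRing ι
    fun a r hd ↦ LinearMapIsCrisp.dvd_of_includeRight_dvd hB hd
  have hcomm : ι.comp φ.hom = κ.comp (sectionsMap f (V j) W hW) :=
    (Algebra.TensorProduct.includeRight.comp_algebraMap).trans
      (Algebra.TensorProduct.includeLeft.comp_algebraMap).symm
  let l : Spec (.of C) ⟶ X' := hp.lift (Spec.map (CommRingCat.ofHom ι) ≫ g)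
    (Spec.map (CommRingCat.ofHom κ) ≫ k) (by
      rw [Category.assoc, Category.assoc, ← hg, hk, ← Spec.map_comp_assoc, ← Spec.map_comp_assoc]
      congr 2
      exact CommRingCat.hom_ext hcomm)
  have hl : l ≫ f' = Spec.map (CommRingCat.ofHom ι) ≫ g := hp.lift_fst _ _ _
  have hl' (z : Spec (.of C)) : f' (l z) = g (Spec.map (CommRingCat.ofHom ι) z) := by
    rw [← Scheme.Hom.comp_apply, hl, Scheme.Hom.comp_apply]
  exact ⟨l q, l q', ((PrimeSpectrum.le_iff_specializes q q').mp hle).map l.continuous,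
    (hl' q).trans (congrArg g hq), (hl' q').trans (congrArg g hq')⟩

end Specialization

/-! ### Constructible topologies on spectral spaces -/

section ConstructibleTopology

variable {X Y : Type*} [TopologicalSpace X] [TopologicalSpace Y]

/-- Openness of the complement is carried along so that the induction passes through complements. -/
lemma isOpen_constructibleTopology_of_isConstructible [CompactSpace X] {s : Set X}
    (hs : IsConstructible s) :
    IsOpen[_root_.constructibleTopology X] s ∧ IsOpen[_root_.constructibleTopology X] sᶜ := by
  induction hs using IsConstructible.empty_union_induction with
  | open_retrocompact U hU hU' =>
    refine ⟨hU'.isCompact.isOpen_constructibleTopology_of_isOpen hU,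
      IsCompact.isOpen_constructibleTopology_of_isClosed ?_ hU.isClosed_compl⟩
    rw [compl_compl]
    exact hU'.isCompact
  | union s _ t _ hs ht =>
    rw [Set.compl_union]
    exact ⟨@IsOpen.union X s t (_root_.constructibleTopology X) hs.1 ht.1,
      @IsOpen.inter X (_root_.constructibleTopology X) _ _ hs.2 ht.2⟩
  | compl s _ hs => exact ⟨hs.2, (compl_compl s).symm ▸ hs.1⟩

/-- In a compact quasi-separated space, the open sets of the constructible topology are the
unions of constructible sets. -/
lemma isOpen_constructibleTopology_iff [CompactSpace X] [QuasiSeparatedSpace X] {s : Set X} :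
    IsOpen[_root_.constructibleTopology X] s ↔
      ∃ 𝒯 : Set (Set X), (∀ T ∈ 𝒯, IsConstructible T) ∧ ⋃₀ 𝒯 = s := by
  constructor
  · intro h
    have hb := @TopologicalSpace.isTopologicalBasis_of_subbasis X (_root_.constructibleTopology X)
      (constructibleTopologySubbasis X) rfl
    obtain ⟨𝒯, h𝒯, rfl⟩ := @TopologicalSpace.IsTopologicalBasis.open_eq_sUnion _
      (_root_.constructibleTopology X) _ hb _ h
    refine ⟨𝒯, fun T hT ↦ ?_, rfl⟩
    obtain ⟨F, ⟨hF, hF'⟩, rfl⟩ := h𝒯 hT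
    refine IsConstructible.sInter hF fun T hT ↦ ?_
    obtain ⟨ho, hc⟩ | ⟨ho, hc⟩ := hF' hT
    · exact hc.isConstructible ho
    · exact isConstructible_compl.mp (hc.isConstructible ho.isOpen_compl)
  · rintro ⟨𝒯, h𝒯, rfl⟩
    exact @isOpen_sUnion _ (_root_.constructibleTopology X) _
      fun T hT ↦ (isOpen_constructibleTopology_of_isConstructible (h𝒯 T hT)).1

/-- The constructible topology of a `T0` prespectral space is Hausdorff. -/
lemma t2Space_constructibleTopology [T0Space X] [PrespectralSpace X] :
    @T2Space X (_root_.constructibleTopology X) := by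
  refine @T2Space.mk _ (_) fun x y hxy ↦ ?_
  -- `T0` separates the two points in one direction only, up to exchanging them.
  wlog h : ∃ U : Set X, IsOpen U ∧ x ∈ U ∧ y ∉ U generalizing x y
  · obtain ⟨U, hU, h'⟩ := exists_isOpen_xor_mem hxy
    obtain ⟨V, W, hV, hW, hyV, hxW, hVW⟩ :=
      this y x hxy.symm ⟨U, hU, (h'.resolve_left fun h' ↦ h ⟨U, hU, h'⟩)⟩
    exact ⟨W, V, hW, hV, hxW, hyV, hVW.symm⟩
  obtain ⟨U, hU, hx, hy⟩ := h
  obtain ⟨V, ⟨hV, hV'⟩, hxV, hVU⟩ :=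
    PrespectralSpace.isTopologicalBasis.exists_subset_of_mem_open hx hU
  refine ⟨V, Vᶜ, hV'.isOpen_constructibleTopology_of_isOpen hV,
    IsCompact.isOpen_constructibleTopology_of_isClosed ?_ hV.isClosed_compl, hxV,
    fun h ↦ hy (hVU h), disjoint_compl_right⟩
  rwa [compl_compl]

lemma continuous_constructibleTopology {f : X → Y} (hf : IsSpectralMap f) :
    @Continuous _ _ (_root_.constructibleTopology X) (_root_.constructibleTopology Y) f := by
  refine @continuous_generateFrom_iff _ _ (_) _ _ |>.mpr ?_
  rintro s (⟨ho, hc⟩ | ⟨ho, hc⟩)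
  · exact (hf.isCompact_preimage_of_isOpen ho hc).isOpen_constructibleTopology_of_isOpen
      (ho.preimage hf.continuous)
  · refine IsCompact.isOpen_constructibleTopology_of_isClosed ?_ (ho.preimage hf.continuous)
    exact hf.isCompact_preimage_of_isOpen ho.isOpen_compl hc

/-- A surjective spectral map of spectral spaces is a quotient map for the constructible
topologies. -/
lemma isQuotientMap_constructibleTopology [CompactSpace X] [QuasiSober X] [PrespectralSpace X]
    [QuasiSeparatedSpace X] [T0Space Y] [PrespectralSpace Y] {f : X → Y} (hf : IsSpectralMap f)
    (hs : Function.Surjective f) :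
    @IsQuotientMap _ _ (_root_.constructibleTopology X) (_root_.constructibleTopology Y) f := by
  have hT2 : @T2Space Y (_root_.constructibleTopology Y) := t2Space_constructibleTopology
  have hc : @CompactSpace X (_root_.constructibleTopology X) :=
    @Function.Surjective.compactSpace _ _ _ (_root_.constructibleTopology X) _
      (WithTopology.continuous_ofTopology _) _ (WithTopology.ofTopology_surjective _)
  have hcont := continuous_constructibleTopology hf
  exact @IsClosedMap.isQuotientMap _ _ _ (_root_.constructibleTopology X)
    (_root_.constructibleTopology Y) (@Continuous.isClosedMap _ _ (_root_.constructibleTopology X)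
      (_root_.constructibleTopology Y) hc hT2 _ hcont) hcont hs

end ConstructibleTopology

/-! ### Quotient topologies on schemes -/

section Scheme

variable {X Y Z : Scheme.{u}}

/-- The preimage of an ind-constructible set under a morphism from an affine scheme is a union of
constructible sets. -/
lemma IsIndConstructible.exists_sUnion_eq_preimage {S : Set Y} (hS : IsIndConstructible S)
    (g : Z ⟶ Y) [IsAffine Z] :
    ∃ 𝒯 : Set (Set Z), (∀ T ∈ 𝒯, IsConstructible T) ∧ ⋃₀ 𝒯 = g ⁻¹' S := by
  -- Taking all constructible subsets of the preimage makes the claim local at each point `z`.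
  refine ⟨{T | IsConstructible T ∧ T ⊆ g ⁻¹' S}, fun T hT ↦ hT.1,
    (Set.sUnion_subset fun T hT ↦ hT.2).antisymm fun z hz ↦ ?_⟩
  obtain ⟨V, hV, hzV, -⟩ := exists_isAffineOpen_mem_and_subset (TopologicalSpace.Opens.mem_top (g z))
  obtain ⟨W, hW, hzW, hWV⟩ := exists_isAffineOpen_mem_and_subset (U := g ⁻¹ᵁ V) hzV
  have : IsAffine V := hV
  have : IsAffine W := hW
  obtain ⟨𝒯, h𝒯, hun⟩ := hS V hV
  obtain ⟨T, hT, hzT⟩ : (⟨g z, hzV⟩ : (V : Set Y)) ∈ ⋃₀ 𝒯 := hun ▸ hz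
  let k : W.toScheme ⟶ V.toScheme := g.resLE V W hWV
  have hk (w : W) : (k w).1 = g w.1 := by
    change (k ≫ V.ι) w = _
    rw [g.resLE_comp_ι hWV]
    rfl
  have hc : IsConstructible (k ⁻¹' T) := (h𝒯 T hT).preimage k.continuous fun s hs hs' ↦
    (k.isSpectralMap.isCompact_preimage_of_isOpen hs hs'.isCompact).isRetrocompact
      (hs.preimage k.continuous)
  refine ⟨W.ι '' (k ⁻¹' T), ⟨hc.image_of_isOpenEmbedding W.ι.isOpenEmbedding ?_, ?_⟩,
    ⟨z, hzW⟩, ?_, rfl⟩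
  · rw [Scheme.Opens.range_ι]
    exact hW.isCompact.isRetrocompact W.2
  · rintro _ ⟨w, hw, rfl⟩
    have : k w ∈ (V : Set Y) ↓∩ S := hun ▸ ⟨T, hT, hw⟩
    exact (hk w ▸ this : g w.1 ∈ S)
  · have : k ⟨z, hzW⟩ = ⟨g z, hzV⟩ := Subtype.ext (hk _)
    exact Set.mem_preimage.mpr (this ▸ hzT)

lemma IsIndConstructible.preimage {S : Set Y} (hS : IsIndConstructible S) (f : X ⟶ Y) :
    IsIndConstructible (f ⁻¹' S) := by
  intro U hU
  have : IsAffine U := hU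
  exact hS.exists_sUnion_eq_preimage (U.ι ≫ f)

/-- If `f` is quasi-compact and surjective, every affine open of `Y` is the image of an affine
scheme over `X`. -/
lemma exists_surjective_of_isAffineOpen (f : X ⟶ Y) [QuasiCompact f]
    (hs : Function.Surjective f) {V : Y.Opens} (hV : IsAffineOpen V) :
    ∃ (R : CommRingCat.{u}) (g : Spec R ⟶ X) (h : Spec R ⟶ V), g ≫ f = h ≫ V.ι ∧
      Function.Surjective h := by
  obtain ⟨R, g, hg⟩ := isCompact_iff_exists.mp (f.isCompact_preimage hV.isCompact)
  have hr : Set.range (g ≫ f) ⊆ Set.range V.ι := by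
    rw [Scheme.Opens.range_ι]
    rintro _ ⟨z, rfl⟩
    exact (hg ▸ Set.mem_range_self z : g z ∈ ((f ⁻¹ᵁ V : X.Opens) : Set X))
  have hl := IsOpenImmersion.lift_fac V.ι (g ≫ f) hr
  refine ⟨R, g, IsOpenImmersion.lift V.ι (g ≫ f) hr, hl.symm, fun v ↦ ?_⟩
  obtain ⟨x, hx⟩ := hs v.1
  obtain ⟨z, rfl⟩ : x ∈ Set.range g := by
    rw [hg]
    exact (hx ▸ v.2 : f x ∈ V)
  refine ⟨z, V.ι.injective ?_⟩
  rw [← Scheme.Hom.comp_apply, hl, Scheme.Hom.comp_apply, hx]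
  rfl

/-- A quasi-compact surjective morphism is submersive for the constructible topologies. -/
lemma isQuotientMap_constructibleTopology_of_quasiCompact (f : X ⟶ Y) [QuasiCompact f]
    (hs : Function.Surjective f) :
    @IsQuotientMap X Y (constructibleTopology X) (constructibleTopology Y) f := by
  refine @IsQuotientMap.mk _ _ (_) (_) _ ((@isCoinducing_iff _ _ _ (_) (_)).mpr fun S ↦
    ⟨fun h V hV ↦ ?_, fun h ↦ IsIndConstructible.preimage h f⟩) hs
  have : IsAffine V := hV
  have : CompactSpace (V : Set Y) := inferInstanceAs (CompactSpace V.toScheme)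
  have : QuasiSeparatedSpace (V : Set Y) := inferInstanceAs (QuasiSeparatedSpace V.toScheme)
  obtain ⟨R, g, k, hk, hks⟩ := exists_surjective_of_isAffineOpen f hs hV
  rw [← isOpen_constructibleTopology_iff]
  -- Openness over `V` is tested after pulling back along `k`, where the set is also the preimage
  -- under `g` of `f ⁻¹' S`, ind-constructible by assumption.
  refine (@IsCoinducing.isOpen_preimage _ _ _ (_) (_)
    (@IsQuotientMap.isCoinducing _ _ (_) (_) _
      (isQuotientMap_constructibleTopology k.isSpectralMap hks)) _).mp ?_
  rw [isOpen_constructibleTopology_iff]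
  convert IsIndConstructible.exists_sUnion_eq_preimage h g using 4
  change (k ≫ V.ι) ⁻¹' S = _
  rw [← hk]
  rfl

/-- By surjectivity `T` is the image of the closed set `k ⁻¹' T`, and for a map of affine schemes
such an image is closed once stable under specialisation. -/
lemma isClosed_of_surjective_of_isClosed_preimage {R : CommRingCat.{u}} [IsAffine Y]
    (k : Spec R ⟶ Y) (hk : Function.Surjective k) {T : Set Y} (hT : StableUnderSpecialization T)
    (hc : IsClosed (k ⁻¹' T)) : IsClosed T := by
  let e := Y.isoSpec.hom
  obtain ⟨φ, hφ⟩ := Spec.map_surjective (k ≫ e)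
  have himg : Spec.map φ '' (k ⁻¹' T) = e '' T := by
    rw [hφ, Scheme.Hom.comp_base, TopCat.coe_comp, Set.image_comp, Set.image_preimage_eq _ hk]
  rw [← e.homeomorph.isClosed_image]
  change IsClosed (e '' T)
  rw [← himg]
  refine PrimeSpectrum.isClosed_image_of_stableUnderSpecialization φ.hom _ hc ?_
  change StableUnderSpecialization (Spec.map φ '' (k ⁻¹' T))
  rw [himg]
  exact hT.image e.homeomorph.isClosedMap.specializingMap

/-- A quasi-compact morphism along which specialisations lift is submersive. -/
lemma isQuotientMap_of_exists_specializes (f : X ⟶ Y) [QuasiCompact f]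
    (h : ∀ y y' : Y, y ⤳ y' → ∃ x x' : X, x ⤳ x' ∧ f x = y ∧ f x' = y') : IsQuotientMap f := by
  have hs : Function.Surjective f := fun y ↦
    let ⟨x, _, _, hx, _⟩ := h y y specializes_rfl
    ⟨x, hx⟩
  refine isQuotientMap_iff_isClosed.mpr ⟨hs, fun T ↦ ⟨fun hT ↦ hT.preimage f.continuous,
    fun hT ↦ ?_⟩⟩
  have hT' : StableUnderSpecialization T := by
    intro y y' hy hyT
    obtain ⟨x, x', hx, rfl, rfl⟩ := h y y' hy
    exact hT.stableUnderSpecialization hx hyT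
  have hcov : TopologicalSpace.IsOpenCover fun V : Y.affineOpens ↦ V.1 :=
    iSup_affineOpens_eq_top Y
  refine hcov.isClosed_iff_coe_preimage.mpr fun V ↦ ?_
  obtain ⟨R, g, k, hk, hks⟩ := exists_surjective_of_isAffineOpen f hs V.2
  refine isClosed_of_surjective_of_isClosed_preimage k hks
    (hT'.preimage continuous_subtype_val) ?_
  change IsClosed ((k ≫ V.1.ι) ⁻¹' T)
  rw [← hk]
  exact hT.preimage g.continuous

end Scheme

end Crisp

theorem proposition2p18 {X Y : AlgebraicGeometry.Scheme.{u}} (f : X ⟶ Y)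
    [AlgebraicGeometry.QuasiCompact f] (hf : Crisp.IsCrisp f) :
    Crisp.IsSubtrusive.universally f ∧ Crisp.IsSubmersive.universally f := by
  have hqc {X' Y' : Scheme.{u}} {i₁ : X' ⟶ X} {i₂ : Y' ⟶ Y} {f' : X' ⟶ Y'}
      (hp : IsPullback f' i₁ i₂ f) : QuasiCompact f' :=
    MorphismProperty.of_isPullback (P := @QuasiCompact) hp.flip inferInstance
  refine ⟨fun X' Y' i₁ i₂ f' hp ↦ ?_, fun X' Y' i₁ i₂ f' hp ↦ ?_⟩
  · have := hqc hp
    have h := fun y y' (hy : y ⤳ y') ↦ hf.exists_specializes hp hy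
    exact ⟨h, Crisp.isQuotientMap_constructibleTopology_of_quasiCompact f' fun y ↦
      let ⟨x, _, _, hx, _⟩ := h y y specializes_rfl
      ⟨x, hx⟩⟩
  · have := hqc hp
    exact Crisp.isQuotientMap_of_exists_specializes f' fun y y' hy ↦ hf.exists_specializes hp hy
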